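/- Let $n\ge 2$. Let $\mathcal K^n_o$ be the class of compact convex subsets of $\mathbb R^n$ that contain the origin, and let $\mathcal K^n_s\subset\mathcal K^n_o$ be the class of nonempty compact convex subsets of $\mathbb R^n$ that are symmetric about the origin. Write $h_K(x)=\sup\{x\cdot y:y\in K\}$ for the support function of $K$. Let $\varphi:[0,\infty)^2\to[0,\infty)$ be a convex function that is increasing (not necessarily strictly) in each variable and satisfies $\varphi(0,0)=0$ and $\varphi(1,0)=\varphi(0,1)=1$. For $K,L\in\mathcal K^n_o$, the Orlicz sum $K+_\varphi L\in\mathcal K^n_o$ is the compact convex set with support function $$h_{K+_\varphi L}(x)=\inf\left\{\lambda>0:\varphi\left(\frac{h_K(x)}{\lambda},\frac{h_L(x)}{\lambda}\right)\le 1\right\},\qquad x\in\mathbb R^n,$$ and, for $1\le p\le\infty$, the $L_p$ sum $K+_pL\in\mathcal K^n_o$ is the compact convex set with support function $h_{K+_pL}=(h_K^p+h_L^p)^{1/p}$ if $p<\infty$ and $h_{K+_\infty L}=\max\{h_K,h_L\}$. Both operations map $(\mathcal K^n_s)^2$ into $\mathcal K^n_s$. For each of the two classes $\mathcal C=\mathcal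 K^n_s$ and $\mathcal C=\mathcal K^n_o$, the operation $+_\varphi:\mathcal C^2\to\mathcal C$ is associative, that is, $K+_\varphi(L+_\varphi N)=(K+_\varphi L)+_\varphi N$ for all $K,L,N\in\mathcal C$, if and only if there is a $p$ with $1\le p\le\infty$ such that $K+_\varphi L=K+_pL$ for all $K,L\in\mathcal C$. -/

import Mathlib

namespace OrliczAddition

open Set
open scoped ENNReal RealInnerProductSpace

/-- Euclidean `n`-space. -/
abbrev E (n : ℕ) : Type := EuclideanSpace ℝ (Fin n)

/-- The class of compact convex subsets of `ℝⁿ` that contain the origin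
(Mathlib's `ConvexBody` is a nonempty compact convex set; its interior may be empty). -/
def Ko (n : ℕ) : Type := {K : ConvexBody (E n) // (0 : E n) ∈ K}

/-- The underlying set of points. -/
def Ko.toSet {n : ℕ} (K : Ko n) : Set (E n) := (K.1 : Set (E n))

/-- The class of `o`-symmetric nonempty compact convex sets, as a subclass of `Ko n`
(see `zero_mem_of_symmetric`: such a set always contains the origin). -/
def Ks (n : ℕ) : Set (Ko n) := {K | ∀ x ∈ K.toSet, -x ∈ K.toSet}

/-- The support function `h_K(x) = sup {x · y : y ∈ K}`. -/
noncomputable def supp {n : ℕ} (K : Ko n) (x : E n) : ℝ :=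
  sSup ((fun y : E n => ⟪x, y⟫) '' K.toSet)

/-- The class `Φ₂` of convex functions `φ : [0,∞)² → [0,∞)` that are increasing (in the weak
sense) in each variable, with `φ(0,0) = 0` and `φ(1,0) = φ(0,1) = 1`. The function is given on
all of `ℝ²`; its values outside the quadrant `[0,∞)²` are unconstrained and never used. -/
structure IsPhi2 (φ : ℝ × ℝ → ℝ) : Prop where
  convex : ConvexOn ℝ (Ici (0 : ℝ) ×ˢ Ici (0 : ℝ)) φ
  nonneg : ∀ a b : ℝ, 0 ≤ a → 0 ≤ b → 0 ≤ φ (a, b)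
  mono_left : ∀ a a' b : ℝ, 0 ≤ a → a ≤ a' → 0 ≤ b → φ (a, b) ≤ φ (a', b)
  mono_right : ∀ a b b' : ℝ, 0 ≤ a → 0 ≤ b → b ≤ b' → φ (a, b) ≤ φ (a, b')
  map_zero : φ (0, 0) = 0
  map_e1 : φ (1, 0) = 1
  map_e2 : φ (0, 1) = 1

/-- The number `inf {t > 0 : φ(a/t, b/t) ≤ 1}`. -/
noncomputable def orliczValue (φ : ℝ × ℝ → ℝ) (a b : ℝ) : ℝ :=
  sInf {t : ℝ | 0 < t ∧ φ (a / t, b / t) ≤ 1}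

/-- The number `(a^p + b^p)^(1/p)` if `p < ∞` and `max a b` if `p = ∞`. -/
noncomputable def lpValue (p : ℝ≥0∞) (a b : ℝ) : ℝ :=
  if p = ∞ then max a b else (a ^ p.toReal + b ^ p.toReal) ^ (1 / p.toReal)

theorem isCompact_wulff {n : ℕ} (g : E n → ℝ) :
    IsCompact {y : E n | ∀ x : E n, ⟪x, y⟫ ≤ g x} := by
  apply Metric.isCompact_of_isClosed_isBounded
  · rw [ofPred_forall]
    exact isClosed_iInter fun x => isClosed_le (by fun_prop) continuous_const
  · rw [isBounded_iff_forall_norm_le]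
    refine ⟨∑ i : Fin n, max (g (EuclideanSpace.basisFun (Fin n) ℝ i))
      (g (-(EuclideanSpace.basisFun (Fin n) ℝ i))), fun y hy => ?_⟩
    rw [← (EuclideanSpace.basisFun (Fin n) ℝ).sum_repr' y]
    refine (norm_sum_le _ _).trans (Finset.sum_le_sum fun i _ => ?_)
    rw [norm_smul, OrthonormalBasis.norm_eq_one, mul_one, Real.norm_eq_abs]
    refine abs_le'.2 ⟨(hy _).trans (le_max_left _ _), ?_⟩
    rw [← inner_neg_left]
    exact (hy _).trans (le_max_right _ _)

/-- The compact convex set `{y : x · y ≤ g(x) for all x}` for a nonnegative function `g`. If `g` is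
sublinear, this is the unique compact convex set with support function `g`; see `supp_wulff`
and `eq_of_supp_eq`. -/
def wulff {n : ℕ} (g : E n → ℝ) (hg : ∀ x, 0 ≤ g x) : Ko n :=
  ⟨{ carrier := {y : E n | ∀ x : E n, ⟪x, y⟫ ≤ g x}
     convex' := by
       rw [ofPred_forall]
       refine convex_iInter fun x => ?_
       intro y hy z hz a b ha hb hab
       have hy' : ⟪x, y⟫ ≤ g x := hy
       have hz' : ⟪x, z⟫ ≤ g x := hz
       change ⟪x, a • y + b • z⟫ ≤ g x
       rw [inner_add_right, inner_smul_right, inner_smul_right]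
       have e : g x = a * g x + b * g x := by rw [← add_mul, hab, one_mul]
       rw [e]
       gcongr
     isCompact' := isCompact_wulff g
     nonempty' := ⟨0, fun x => by simpa using hg x⟩ },
    fun x => by simpa using hg x⟩

theorem mem_wulff {n : ℕ} {g : E n → ℝ} {hg : ∀ x, 0 ≤ g x} {y : E n} :
    y ∈ (wulff g hg).toSet ↔ ∀ x : E n, ⟪x, y⟫ ≤ g x := Iff.rfl

theorem bddAbove_supp {n : ℕ} (K : Ko n) (x : E n) :
    BddAbove ((fun y : E n => ⟪x, y⟫) '' K.toSet) :=
  (K.1.isCompact.image (by fun_prop)).bddAbove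

theorem le_supp {n : ℕ} {K : Ko n} {y : E n} (hy : y ∈ K.toSet) (x : E n) : ⟪x, y⟫ ≤ supp K x :=
  le_csSup (bddAbove_supp K x) ⟨y, hy, rfl⟩

theorem supp_le {n : ℕ} {K : Ko n} {x : E n} {c : ℝ} (h : ∀ y ∈ K.toSet, ⟪x, y⟫ ≤ c) :
    supp K x ≤ c := by
  refine csSup_le ⟨_, 0, K.2, rfl⟩ ?_
  rintro _ ⟨y, hy, rfl⟩
  exact h y hy

theorem supp_nonneg {n : ℕ} (K : Ko n) (x : E n) : 0 ≤ supp K x := by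
  simpa using le_supp (K := K) K.2 x

theorem orliczValue_nonneg (φ : ℝ × ℝ → ℝ) (a b : ℝ) : 0 ≤ orliczValue φ a b :=
  Real.sInf_nonneg fun _ ht => ht.1.le

theorem lpValue_nonneg (p : ℝ≥0∞) {a b : ℝ} (ha : 0 ≤ a) (hb : 0 ≤ b) : 0 ≤ lpValue p a b := by
  unfold lpValue
  split_ifs
  · exact le_max_of_le_left ha
  · positivity

/-- Orlicz addition `+_φ`: for `φ` in `Φ₂`, the compact convex set with support function
`x ↦ inf {t > 0 : φ(h_K(x)/t, h_L(x)/t) ≤ 1}`; see `supp_orliczAdd`. -/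
noncomputable def orliczAdd {n : ℕ} (φ : ℝ × ℝ → ℝ) (K L : Ko n) : Ko n :=
  wulff (fun x => orliczValue φ (supp K x) (supp L x)) (fun _ => orliczValue_nonneg φ _ _)

/-- `L_p` addition `+_p`: for `1 ≤ p ≤ ∞`, the compact convex set with support function
`(h_K^p + h_L^p)^(1/p)` if `p < ∞` and `max {h_K, h_L}` if `p = ∞`; see `supp_lpAdd`. -/
noncomputable def lpAdd {n : ℕ} (p : ℝ≥0∞) (K L : Ko n) : Ko n :=
  wulff (fun x => lpValue p (supp K x) (supp L x))
    (fun x => lpValue_nonneg p (supp_nonneg K x) (supp_nonneg L x))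

/-- Associativity of an operation on a class of sets. -/
def AssocOn {n : ℕ} (C : Set (Ko n)) (op : Ko n → Ko n → Ko n) : Prop :=
  ∀ K ∈ C, ∀ L ∈ C, ∀ N ∈ C, op K (op L N) = op (op K L) N

/-- Two operations agree on a class of sets. -/
def AgreeOn {n : ℕ} (C : Set (Ko n)) (op op' : Ko n → Ko n → Ko n) : Prop :=
  ∀ K ∈ C, ∀ L ∈ C, op K L = op' K L

/-! Proved facts showing that the definitions above are the intended ones. -/

theorem zero_mem_of_symmetric {n : ℕ} (K : ConvexBody (E n)) (hK : ∀ x ∈ K, -x ∈ K) :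
    (0 : E n) ∈ K := by
  obtain ⟨x, hx⟩ := K.nonempty
  have h := K.convex hx (hK x hx) (by norm_num : (0 : ℝ) ≤ 1 / 2) (by norm_num : (0 : ℝ) ≤ 1 / 2)
    (by norm_num)
  simpa using h

theorem supp_smul {n : ℕ} (K : Ko n) {c : ℝ} (hc : 0 < c) (x : E n) :
    supp K (c • x) = c * supp K x := by
  apply le_antisymm
  · refine supp_le fun y hy => ?_
    rw [real_inner_smul_left]
    exact mul_le_mul_of_nonneg_left (le_supp hy x) hc.le
  · rw [← le_div_iff₀' hc]
    refine supp_le fun y hy => ?_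
    rw [le_div_iff₀' hc, ← real_inner_smul_left]
    exact le_supp hy _

theorem supp_add_le {n : ℕ} (K : Ko n) (x z : E n) : supp K (x + z) ≤ supp K x + supp K z :=
  supp_le fun y hy => by
    rw [inner_add_left]
    exact add_le_add (le_supp hy x) (le_supp hy z)

/-- A nonnegative sublinear function is the support function of its `wulff` set. -/
theorem supp_wulff {n : ℕ} (g : E n → ℝ) (hg : ∀ x, 0 ≤ g x)
    (hom : ∀ c : ℝ, 0 < c → ∀ x, g (c • x) = c * g x)
    (sub : ∀ x y, g (x + y) ≤ g x + g y) (x : E n) : supp (wulff g hg) x = g x := by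
  refine le_antisymm (supp_le fun y hy => hy x) ?_
  by_cases hx : x = 0
  · have h0 : g 0 = 0 := by
      have := hom 2 (by norm_num) 0
      rw [smul_zero] at this
      linarith
    subst hx
    rw [h0]
    exact supp_nonneg _ _
  · obtain ⟨f, hf1, hf2⟩ := exists_extension_of_le_sublinear
      (LinearPMap.mkSpanSingleton x (g x) hx) g hom sub (by
        rintro ⟨z, hz⟩
        obtain ⟨c, rfl⟩ := Submodule.mem_span_singleton.1 hz
        rw [LinearPMap.mkSpanSingleton'_apply]
        change c * g x ≤ g (c • x)
        rcases lt_trichotomy c 0 with h | h | h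
        · exact (mul_nonpos_of_nonpos_of_nonneg h.le (hg x)).trans (hg _)
        · rw [h, zero_mul]
          exact hg _
        · exact (hom c h x).ge)
    have hfx : f x = g x := by
      have := hf1 ⟨x, Submodule.mem_span_singleton_self x⟩
      rw [this]
      exact LinearPMap.mkSpanSingleton_apply ℝ ℝ hx (g x)
    set y : E n := (InnerProductSpace.toDual ℝ (E n)).symm (LinearMap.toContinuousLinearMap f)
      with hy
    have key : ∀ z : E n, ⟪z, y⟫ = f z := fun z => by
      rw [real_inner_comm, hy, InnerProductSpace.toDual_symm_apply]
      rfl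
    have hyw : y ∈ (wulff g hg).toSet := fun z => (key z).trans_le (hf2 z)
    rw [← hfx, ← key x]
    exact le_supp hyw x

theorem orliczValue_smul (φ : ℝ × ℝ → ℝ) {c : ℝ} (hc : 0 < c) (a b : ℝ) :
    orliczValue φ (c * a) (c * b) = c * orliczValue φ a b := by
  unfold orliczValue
  rw [← smul_eq_mul, ← smul_eq_mul, ← smul_eq_mul, ← Real.sInf_smul_of_nonneg hc.le]
  congr 1
  ext t
  rw [mem_smul_set]
  constructor
  · rintro ⟨ht, h⟩
    refine ⟨t / c, ⟨by positivity, ?_⟩, by simp [mul_div_cancel₀, hc.ne']⟩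
    convert h using 3 <;> simp only [smul_eq_mul] <;> field_simp
  · rintro ⟨s, ⟨hs, h⟩, rfl⟩
    refine ⟨by simp only [smul_eq_mul]; positivity, ?_⟩
    convert h using 3 <;> simp only [smul_eq_mul] <;> field_simp

theorem orliczSet_nonempty {φ : ℝ × ℝ → ℝ} (hφ : IsPhi2 φ) {a b : ℝ} (ha : 0 ≤ a) (hb : 0 ≤ b) :
    {t : ℝ | 0 < t ∧ φ (a / t, b / t) ≤ 1}.Nonempty := by
  have h0 := hφ.nonneg a b ha hb
  set s := φ (a, b) with hs
  refine ⟨s + 1, by positivity, ?_⟩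
  have hpos : 0 < s + 1 := by positivity
  have h := hφ.convex.2 (show ((a, b) : ℝ × ℝ) ∈ Ici (0 : ℝ) ×ˢ Ici (0 : ℝ) from ⟨ha, hb⟩)
    (show ((0, 0) : ℝ × ℝ) ∈ Ici (0 : ℝ) ×ˢ Ici (0 : ℝ) from by simp)
    (show 0 ≤ 1 / (s + 1) by positivity) (show 0 ≤ s / (s + 1) by positivity)
    (by field_simp; ring)
  rw [hφ.map_zero] at h
  simp only [smul_eq_mul, mul_zero, add_zero, Prod.smul_mk, Prod.mk_add_mk, one_div_mul_eq_div,
    ← hs] at h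
  exact h.trans ((div_le_one hpos).2 (by linarith))

theorem orliczSet_bddBelow (φ : ℝ × ℝ → ℝ) (a b : ℝ) :
    BddBelow {t : ℝ | 0 < t ∧ φ (a / t, b / t) ≤ 1} := ⟨0, fun _ ht => ht.1.le⟩

theorem orliczValue_mono {φ : ℝ × ℝ → ℝ} (hφ : IsPhi2 φ) {a b a' b' : ℝ} (ha : 0 ≤ a)
    (hb : 0 ≤ b) (haa : a ≤ a') (hbb : b ≤ b') : orliczValue φ a b ≤ orliczValue φ a' b' := by
  refine le_csInf (orliczSet_nonempty hφ (ha.trans haa) (hb.trans hbb)) ?_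
  rintro t ⟨ht, h⟩
  refine csInf_le (orliczSet_bddBelow φ a b) ⟨ht, ?_⟩
  refine (hφ.mono_left _ (a' / t) _ (by positivity) (by gcongr) (by positivity)).trans ?_
  exact (hφ.mono_right _ _ (b' / t) (div_nonneg (ha.trans haa) ht.le) (by positivity)
    (by gcongr)).trans h

theorem orliczValue_add_le {φ : ℝ × ℝ → ℝ} (hφ : IsPhi2 φ) {a b c d : ℝ} (ha : 0 ≤ a)
    (hb : 0 ≤ b) (hc : 0 ≤ c) (hd : 0 ≤ d) :
    orliczValue φ (a + c) (b + d) ≤ orliczValue φ a b + orliczValue φ c d := by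
  rw [← sub_le_iff_le_add]
  refine le_csInf (orliczSet_nonempty hφ ha hb) ?_
  rintro t ⟨ht, h⟩
  rw [sub_le_comm]
  refine le_csInf (orliczSet_nonempty hφ hc hd) ?_
  rintro s ⟨hs, h'⟩
  rw [sub_le_iff_le_add']
  refine csInf_le (orliczSet_bddBelow φ _ _) ⟨by positivity, ?_⟩
  have hts : 0 < t + s := by positivity
  have k := hφ.convex.2
    (show ((a / t, b / t) : ℝ × ℝ) ∈ Ici (0 : ℝ) ×ˢ Ici (0 : ℝ) from
      ⟨div_nonneg ha ht.le, div_nonneg hb ht.le⟩)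
    (show ((c / s, d / s) : ℝ × ℝ) ∈ Ici (0 : ℝ) ×ˢ Ici (0 : ℝ) from
      ⟨div_nonneg hc hs.le, div_nonneg hd hs.le⟩)
    (show 0 ≤ t / (t + s) by positivity) (show 0 ≤ s / (t + s) by positivity) (by field_simp)
  have e : (t / (t + s)) • ((a / t, b / t) : ℝ × ℝ) + (s / (t + s)) • ((c / s, d / s) : ℝ × ℝ)
      = ((a + c) / (t + s), (b + d) / (t + s)) := by
    simp only [Prod.smul_mk, Prod.mk_add_mk, smul_eq_mul]
    refine Prod.ext ?_ ?_ <;> simp only <;> field_simp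
  rw [e] at k
  refine k.trans ?_
  calc _ ≤ (t / (t + s)) • (1 : ℝ) + (s / (t + s)) • (1 : ℝ) := by gcongr
    _ = 1 := by simp only [smul_eq_mul, mul_one]; field_simp

/-- The support function of the Orlicz sum. -/
theorem supp_orliczAdd {n : ℕ} {φ : ℝ × ℝ → ℝ} (hφ : IsPhi2 φ) (K L : Ko n) (x : E n) :
    supp (orliczAdd φ K L) x
      = sInf {t : ℝ | 0 < t ∧ φ (supp K x / t, supp L x / t) ≤ 1} := by
  refine supp_wulff _ _ (fun c hc x => ?_) (fun x y => ?_) x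
  · simp only [supp_smul _ hc, orliczValue_smul φ hc]
  · exact (orliczValue_mono hφ (supp_nonneg _ _) (supp_nonneg _ _) (supp_add_le K x y)
      (supp_add_le L x y)).trans (orliczValue_add_le hφ (supp_nonneg _ _) (supp_nonneg _ _)
        (supp_nonneg _ _) (supp_nonneg _ _))

theorem lpValue_smul {p : ℝ≥0∞} (hp : 1 ≤ p) {a b c : ℝ} (hc : 0 < c) (ha : 0 ≤ a) (hb : 0 ≤ b) :
    lpValue p (c * a) (c * b) = c * lpValue p a b := by
  unfold lpValue
  split_ifs with h
  · exact (mul_max_of_nonneg a b hc.le).symm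
  · have hp0 : p.toReal ≠ 0 := (ENNReal.toReal_pos (zero_lt_one.trans_le hp).ne' h).ne'
    rw [Real.mul_rpow hc.le ha, Real.mul_rpow hc.le hb, ← mul_add,
      Real.mul_rpow (by positivity) (by positivity), one_div, Real.rpow_rpow_inv hc.le hp0]

theorem lpValue_mono {p : ℝ≥0∞} {a b a' b' : ℝ} (ha : 0 ≤ a) (hb : 0 ≤ b)
    (haa : a ≤ a') (hbb : b ≤ b') : lpValue p a b ≤ lpValue p a' b' := by
  unfold lpValue
  split_ifs with h
  · exact max_le_max haa hbb
  · gcongr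

theorem lpValue_add_le {p : ℝ≥0∞} (hp : 1 ≤ p) {a b c d : ℝ} (ha : 0 ≤ a)
    (hb : 0 ≤ b) (hc : 0 ≤ c) (hd : 0 ≤ d) :
    lpValue p (a + c) (b + d) ≤ lpValue p a b + lpValue p c d := by
  unfold lpValue
  split_ifs with h
  · exact max_add_add_le_max_add_max
  · have hp1 : 1 ≤ p.toReal := by
      simpa using ENNReal.toReal_mono h hp
    have k := Real.Lp_add_le_of_nonneg (Finset.univ : Finset (Fin 2)) (f := ![a, b]) (g := ![c, d])
      hp1 (by intro i _; fin_cases i <;> simp [ha, hb]) (by intro i _; fin_cases i <;> simp [hc, hd])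
    simpa [Fin.sum_univ_two] using k

/-- The support function of the `L_p` sum. -/
theorem supp_lpAdd {n : ℕ} {p : ℝ≥0∞} (hp : 1 ≤ p) (K L : Ko n) (x : E n) :
    supp (lpAdd p K L) x = lpValue p (supp K x) (supp L x) := by
  refine supp_wulff _ _ (fun c hc x => ?_) (fun x y => ?_) x
  · simp only [supp_smul _ hc, lpValue_smul hp hc (supp_nonneg _ _) (supp_nonneg _ _)]
  · exact (lpValue_mono (supp_nonneg _ _) (supp_nonneg _ _) (supp_add_le K x y)
      (supp_add_le L x y)).trans (lpValue_add_le hp (supp_nonneg _ _) (supp_nonneg _ _)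
        (supp_nonneg _ _) (supp_nonneg _ _))

/-- A compact convex set is determined by its support function. -/
theorem eq_of_supp_eq {n : ℕ} {K L : Ko n} (h : ∀ x, supp K x = supp L x) : K = L := by
  have key : ∀ K L : Ko n, (∀ x, supp K x = supp L x) → K.toSet ⊆ L.toSet := by
    intro K L h y hy
    by_contra hyL
    obtain ⟨f, u, hf1, hf2⟩ := geometric_hahn_banach_closed_point L.1.convex L.1.isClosed hyL
    set z : E n := (InnerProductSpace.toDual ℝ (E n)).symm f with hz
    have e : ∀ w : E n, ⟪z, w⟫ = f w := fun w => by
      rw [hz, InnerProductSpace.toDual_symm_apply]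
    have h1 : supp L z ≤ u := supp_le fun w hw => by
      rw [e]
      exact (hf1 w hw).le
    have h2 := le_supp hy z
    rw [e, h] at h2
    linarith
  exact Subtype.ext (SetLike.coe_injective
    (subset_antisymm (key K L h) (key L K fun x => (h x).symm)))

theorem supp_neg {n : ℕ} {K : Ko n} (hK : K ∈ Ks n) (x : E n) : supp K (-x) = supp K x := by
  have key : ∀ x, supp K (-x) ≤ supp K x := fun x => supp_le fun y hy => by
    rw [inner_neg_left, ← inner_neg_right]
    exact le_supp (hK y hy) x
  exact le_antisymm (key x) (by simpa using key (-x))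

theorem wulff_mem_Ks {n : ℕ} {g : E n → ℝ} {hg : ∀ x, 0 ≤ g x} (h : ∀ x, g (-x) = g x) :
    wulff g hg ∈ Ks n := fun y hy x => by
  have := mem_wulff.1 hy (-x)
  rwa [h, inner_neg_left, ← inner_neg_right] at this

/-- Orlicz addition maps pairs of `o`-symmetric sets to `o`-symmetric sets. -/
theorem orliczAdd_mem_Ks {n : ℕ} (φ : ℝ × ℝ → ℝ) {K L : Ko n} (hK : K ∈ Ks n) (hL : L ∈ Ks n) :
    orliczAdd φ K L ∈ Ks n := wulff_mem_Ks fun x => by rw [supp_neg hK, supp_neg hL]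

/-- `L_p` addition maps pairs of `o`-symmetric sets to `o`-symmetric sets. -/
theorem lpAdd_mem_Ks {n : ℕ} (p : ℝ≥0∞) {K L : Ko n} (hK : K ∈ Ks n) (hL : L ∈ Ks n) :
    lpAdd p K L ∈ Ks n := wulff_mem_Ks fun x => by rw [supp_neg hK, supp_neg hL]

end OrliczAddition

/-!
The support function of a ball of radius `a` is `a * ‖x‖`, so associativity of Orlicz addition on
balls already says that the real operation `F a b = orliczValue φ a b` is associative on `[0, ∞)`;
conversely, support functions turn any identity `F = lpValue p` into `K +_φ L = K +_p L`. What has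
to be shown is that an associative operation `F` on `[0, ∞)` that is homogeneous of degree one,
monotone, and has `0` as neutral element is `lpValue p` for some `p`
(`IsHomMonoid.exists_eq_lpValue`).

Let `multiple F n` be the sum of `n` copies of `1` under `F`. By associativity it turns addition
into `F`, and by homogeneity it is multiplicative; it is also monotone. A monotone multiplicative
sequence is a power, `multiple F n = n ^ s` (`rpow_of_monotone_of_map_mul`), unless
`F 1 1 = 1`, in which case `F = max`. If `s > 0`, then `F (m ^ s) (n ^ s) = (m + n) ^ s`;
homogeneity extends this to rational arguments with a common denominator, and monotonicity to
all real arguments. The bound `F 1 1 ≤ 2`, a consequence of the convexity of `φ`, gives `s ≤ 1`,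
so that `p = 1 / s ≥ 1`. Commutativity of `F` is a consequence and is not needed.
-/

namespace OrliczAddition

open Set Filter Topology
open scoped ENNReal RealInnerProductSpace

/-! ### Monotone multiplicative sequences -/

/-- Comparing `n ^ j` with the powers of `2` around it determines `log (f n) / log (f 2)` up to
an error `1 / j`. -/
theorem rpow_of_monotone_of_map_mul {f : ℕ → ℝ} (hmono : Monotone f) (h1 : f 1 = 1)
    (hmul : ∀ m n, f (m * n) = f m * f n) (h2 : 1 < f 2) {n : ℕ} (hn : 1 ≤ n) :
    f n = (n : ℝ) ^ (Real.log (f 2) / Real.log 2) := by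
  have hpow : ∀ m k : ℕ, f (m ^ k) = f m ^ k := by
    intro m k
    induction k with
    | zero => simpa using h1
    | succ k ih => rw [pow_succ, hmul, ih, pow_succ]
  have hfn : 1 ≤ f n := h1 ▸ hmono hn
  have hl2 : 0 < Real.log (f 2) := Real.log_pos h2
  have hL2 : 0 < Real.log 2 := Real.log_pos (by norm_num)
  have hn0 : (0 : ℝ) < n := by exact_mod_cast hn
  have key : ∀ j : ℕ,
      (j : ℝ) * |Real.log (f n) * Real.log 2 - Real.log n * Real.log (f 2)|
        ≤ Real.log 2 * Real.log (f 2) := by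
    intro j
    obtain ⟨k, hk1, hk2⟩ : ∃ k, 2 ^ k ≤ n ^ j ∧ n ^ j ≤ 2 ^ (k + 1) :=
      ⟨Nat.log 2 (n ^ j), Nat.pow_log_le_self 2 (by positivity),
        (Nat.lt_pow_succ_log_self (by norm_num) _).le⟩
    have a1 := hmono hk1
    have a2 := hmono hk2
    rw [hpow, hpow] at a1 a2
    have b1 : (2 : ℝ) ^ k ≤ (n : ℝ) ^ j := by exact_mod_cast hk1
    have b2 : (n : ℝ) ^ j ≤ (2 : ℝ) ^ (k + 1) := by exact_mod_cast hk2
    replace a1 := Real.log_le_log (by positivity) a1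
    replace a2 := Real.log_le_log (by positivity) a2
    replace b1 := Real.log_le_log (by positivity) b1
    replace b2 := Real.log_le_log (by positivity) b2
    simp only [Real.log_pow] at a1 a2 b1 b2
    push_cast at a2 b2
    rw [← abs_of_nonneg (Nat.cast_nonneg (α := ℝ) j), ← abs_mul, abs_le]
    constructor
    · nlinarith [mul_le_mul_of_nonneg_right a1 hL2.le, mul_le_mul_of_nonneg_right b2 hl2.le]
    · nlinarith [mul_le_mul_of_nonneg_right a2 hL2.le, mul_le_mul_of_nonneg_right b1 hl2.le]
  have hzero : Real.log (f n) * Real.log 2 - Real.log n * Real.log (f 2) = 0 := by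
    by_contra h
    obtain ⟨j, hj⟩ := exists_nat_gt (Real.log 2 * Real.log (f 2) /
      |Real.log (f n) * Real.log 2 - Real.log n * Real.log (f 2)|)
    rw [div_lt_iff₀ (abs_pos.2 h)] at hj
    exact (hj.trans_le (key j)).false
  have hlog : Real.log (f n) = Real.log n * (Real.log (f 2) / Real.log 2) := by
    rw [← mul_div_assoc, eq_div_iff hL2.ne']
    linarith
  rw [Real.rpow_def_of_pos hn0, ← hlog, Real.exp_log (by linarith)]

/-! ### Homogeneous associative operations on `[0, ∞)` -/

/-- `F` is an associative operation on `[0, ∞)` with neutral element `0`, monotone in each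
argument and homogeneous of degree one. The neutral element is encoded by its action on `1`,
which is enough by homogeneity. -/
structure IsHomMonoid (F : ℝ → ℝ → ℝ) : Prop where
  hom : ∀ {c : ℝ}, 0 < c → ∀ a b, F (c * a) (c * b) = c * F a b
  mono : ∀ {a b a' b' : ℝ}, 0 ≤ a → 0 ≤ b → a ≤ a' → b ≤ b' → F a b ≤ F a' b'
  one_zero : F 1 0 = 1
  zero_one : F 0 1 = 1
  assoc : ∀ {a b c : ℝ}, 0 ≤ a → 0 ≤ b → 0 ≤ c → F a (F b c) = F (F a b) c

/-- The sum of `n` copies of `1` with respect to the operation `F`. -/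
def multiple (F : ℝ → ℝ → ℝ) : ℕ → ℝ
  | 0 => 0
  | n + 1 => F (multiple F n) 1

namespace IsHomMonoid

variable {F : ℝ → ℝ → ℝ}

theorem zero_zero (h : IsHomMonoid F) : F 0 0 = 0 := by
  have := h.hom (show (0 : ℝ) < 2 by norm_num) 0 0
  rw [mul_zero] at this
  linarith

theorem right_zero (h : IsHomMonoid F) {a : ℝ} (ha : 0 ≤ a) : F a 0 = a := by
  rcases ha.eq_or_lt with rfl | ha
  · exact h.zero_zero
  · simpa [h.one_zero] using h.hom ha 1 0

theorem left_zero (h : IsHomMonoid F) {b : ℝ} (hb : 0 ≤ b) : F 0 b = b := by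
  rcases hb.eq_or_lt with rfl | hb
  · exact h.zero_zero
  · simpa [h.zero_one] using h.hom hb 0 1

theorem le_left (h : IsHomMonoid F) {a b : ℝ} (ha : 0 ≤ a) (hb : 0 ≤ b) : a ≤ F a b :=
  (h.right_zero ha).ge.trans (h.mono ha le_rfl le_rfl hb)

theorem le_right (h : IsHomMonoid F) {a b : ℝ} (ha : 0 ≤ a) (hb : 0 ≤ b) : b ≤ F a b :=
  (h.left_zero hb).ge.trans (h.mono le_rfl hb ha le_rfl)

theorem multiple_nonneg (h : IsHomMonoid F) (n : ℕ) : 0 ≤ multiple F n := by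
  induction n with
  | zero => exact le_rfl
  | succ n ih => exact ih.trans (h.le_left ih zero_le_one)

theorem multiple_monotone (h : IsHomMonoid F) : Monotone (multiple F) :=
  monotone_nat_of_le_succ fun n => h.le_left (h.multiple_nonneg n) zero_le_one

theorem multiple_one (h : IsHomMonoid F) : multiple F 1 = 1 := h.zero_one

theorem multiple_two (h : IsHomMonoid F) : multiple F 2 = F 1 1 := by
  change F (multiple F 1) 1 = _
  rw [h.multiple_one]

theorem multiple_add (h : IsHomMonoid F) (m n : ℕ) :
    multiple F (m + n) = F (multiple F m) (multiple F n) := by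
  induction n with
  | zero => exact (h.right_zero (h.multiple_nonneg m)).symm
  | succ n ih =>
    change F (multiple F (m + n)) 1 = F (multiple F m) (F (multiple F n) 1)
    rw [ih, h.assoc (h.multiple_nonneg m) (h.multiple_nonneg n) zero_le_one]

theorem multiple_mul (h : IsHomMonoid F) (m n : ℕ) :
    multiple F (m * n) = multiple F m * multiple F n := by
  rcases (h.multiple_nonneg m).eq_or_lt with hm | hm
  · have : m = 0 := by
      by_contra h0
      have := h.multiple_monotone (Nat.one_le_iff_ne_zero.2 h0)
      rw [h.multiple_one] at this
      linarith
    simp [this, multiple]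
  · induction n with
    | zero => simp [multiple]
    | succ n ih =>
      rw [mul_add, mul_one, h.multiple_add, ih]
      simpa [multiple] using h.hom hm (multiple F n) 1

/-- If `1` is idempotent, then so is every element, and an idempotent monotone operation that
dominates both arguments is the maximum. -/
theorem eq_max (h : IsHomMonoid F) (h11 : F 1 1 = 1) {a b : ℝ} (ha : 0 ≤ a) (hb : 0 ≤ b) :
    F a b = max a b := by
  refine le_antisymm ?_ (max_le (h.le_left ha hb) (h.le_right ha hb))
  refine (h.mono ha hb (le_max_left a b) (le_max_right a b)).trans ?_
  rcases (le_max_of_le_left ha : 0 ≤ max a b).eq_or_lt with h0 | h0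
  · rw [← h0, h.zero_zero]
  · simpa [h11] using (h.hom h0 1 1).le

/-- Rational arguments with denominator `k` lie above and below `x` and `y`, at distance at most
`1 / k`. Monotonicity then traps `F (x ^ s) (y ^ s)` between two sequences with the common limit
`(x + y) ^ s`. -/
theorem apply_rpow (h : IsHomMonoid F) {s : ℝ} (hs : 0 < s)
    (hF : ∀ n : ℕ, multiple F n = (n : ℝ) ^ s) {x y : ℝ} (hx : 0 ≤ x) (hy : 0 ≤ y) :
    F (x ^ s) (y ^ s) = (x + y) ^ s := by
  have hrat : ∀ m n k : ℕ, 0 < k →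
      F (((m : ℝ) / k) ^ s) (((n : ℝ) / k) ^ s) = ((m : ℝ) / k + (n : ℝ) / k) ^ s := by
    intro m n k hk
    have hk' : (0 : ℝ) < (k : ℝ)⁻¹ := by positivity
    have := h.hom (Real.rpow_pos_of_pos hk' s) (multiple F m) (multiple F n)
    rw [← h.multiple_add, hF, hF, hF, ← Real.mul_rpow hk'.le (by positivity),
      ← Real.mul_rpow hk'.le (by positivity), ← Real.mul_rpow hk'.le (by positivity)] at this
    push_cast at this
    simpa only [div_eq_inv_mul, ← mul_add] using this
  have hcast := tendsto_natCast_atTop_atTop (R := ℝ)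
  refine le_antisymm ?_ ?_
  · have hlim := ((((tendsto_nat_ceil_mul_div_atTop hx).comp hcast).add
      ((tendsto_nat_ceil_mul_div_atTop hy).comp hcast)).rpow_const (p := s) (Or.inr hs.le))
    refine ge_of_tendsto hlim ?_
    filter_upwards [eventually_gt_atTop 0] with k hk
    have hk' : (0 : ℝ) < k := by exact_mod_cast hk
    simp only [Function.comp]
    rw [← hrat _ _ k hk]
    refine h.mono (by positivity) (by positivity) ?_ ?_ <;>
    · gcongr
      rw [le_div_iff₀ hk']
      exact Nat.le_ceil _
  · have hlim := ((((tendsto_nat_floor_mul_div_atTop hx).comp hcast).add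
      ((tendsto_nat_floor_mul_div_atTop hy).comp hcast)).rpow_const (p := s) (Or.inr hs.le))
    refine le_of_tendsto hlim ?_
    filter_upwards [eventually_gt_atTop 0] with k hk
    have hk' : (0 : ℝ) < k := by exact_mod_cast hk
    simp only [Function.comp]
    rw [← hrat _ _ k hk]
    refine h.mono (by positivity) (by positivity) ?_ ?_ <;>
    · gcongr
      rw [div_le_iff₀ hk']
      exact Nat.floor_le (by positivity)

theorem exists_eq_lpValue (h : IsHomMonoid F) (h11 : F 1 1 ≤ 2) :
    ∃ p : ℝ≥0∞, 1 ≤ p ∧ ∀ a b : ℝ, 0 ≤ a → 0 ≤ b → F a b = lpValue p a b := by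
  rcases (h.le_left zero_le_one zero_le_one : 1 ≤ F 1 1).eq_or_lt with h1 | h1
  · refine ⟨∞, le_top, fun a b ha hb => ?_⟩
    rw [lpValue, if_pos rfl, h.eq_max h1.symm ha hb]
  · set s := Real.log (multiple F 2) / Real.log 2 with hs_def
    rw [← h.multiple_two] at h1 h11
    have hL2 : 0 < Real.log 2 := Real.log_pos (by norm_num)
    have hs : 0 < s := div_pos (Real.log_pos h1) hL2
    have hs1 : s ≤ 1 := (div_le_one hL2).2 (Real.log_le_log (by linarith) h11)
    have hF : ∀ n : ℕ, multiple F n = (n : ℝ) ^ s := by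
      intro n
      rcases Nat.eq_zero_or_pos n with rfl | hn
      · simp [multiple, Real.zero_rpow hs.ne']
      · exact rpow_of_monotone_of_map_mul h.multiple_monotone h.multiple_one h.multiple_mul h1 hn
    refine ⟨ENNReal.ofReal s⁻¹, ?_, fun a b ha hb => ?_⟩
    · exact ENNReal.one_le_ofReal.2 ((one_le_inv₀ hs).2 hs1)
    · rw [lpValue, if_neg ENNReal.ofReal_ne_top, ENNReal.toReal_ofReal (by positivity), one_div,
        inv_inv, ← h.apply_rpow hs hF (by positivity) (by positivity),
        Real.rpow_inv_rpow ha hs.ne', Real.rpow_inv_rpow hb hs.ne']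

end IsHomMonoid

theorem lpValue_assoc {p : ℝ≥0∞} (hp : 1 ≤ p) {a b c : ℝ} (ha : 0 ≤ a) (hb : 0 ≤ b)
    (hc : 0 ≤ c) : lpValue p a (lpValue p b c) = lpValue p (lpValue p a b) c := by
  unfold lpValue
  split_ifs with h
  · exact (max_assoc a b c).symm
  · have hp0 : p.toReal ≠ 0 := (ENNReal.toReal_pos (zero_lt_one.trans_le hp).ne' h).ne'
    rw [one_div, Real.rpow_inv_rpow (by positivity) hp0, Real.rpow_inv_rpow (by positivity) hp0,
      add_assoc]

/-! ### The real operation underlying Orlicz addition -/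

/-- A convex function `g` with `g 0 = 0` and `g 1 = 1` satisfies `g r ≥ r > 1` for `r > 1`. Here
`g r = φ (r * u, r * v)`, where `φ (u, v) = 1`, so no `t < 1` is admissible in the infimum. -/
theorem orliczValue_eq_one {φ : ℝ × ℝ → ℝ} (hφ : IsPhi2 φ) {u v : ℝ} (hu : 0 ≤ u) (hv : 0 ≤ v)
    (h : φ (u, v) = 1) : orliczValue φ u v = 1 := by
  refine le_antisymm (csInf_le (orliczSet_bddBelow φ _ _) ⟨one_pos, by simp [h]⟩)
    (le_csInf (orliczSet_nonempty hφ hu hv) ?_)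
  rintro t ⟨ht, hle⟩
  by_contra! hlt
  have hc := hφ.convex.2
    (show ((u / t, v / t) : ℝ × ℝ) ∈ Ici (0 : ℝ) ×ˢ Ici (0 : ℝ) from
      ⟨div_nonneg hu ht.le, div_nonneg hv ht.le⟩)
    (show ((0, 0) : ℝ × ℝ) ∈ Ici (0 : ℝ) ×ˢ Ici (0 : ℝ) from by simp)
    ht.le (sub_nonneg.2 hlt.le) (by ring)
  simp only [hφ.map_zero, smul_eq_mul, mul_zero, add_zero, Prod.smul_mk, Prod.mk_add_mk,
    mul_div_cancel₀ _ ht.ne', h] at hc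
  nlinarith

theorem isHomMonoid_orliczValue {φ : ℝ × ℝ → ℝ} (hφ : IsPhi2 φ)
    (hassoc : ∀ a b c : ℝ, 0 ≤ a → 0 ≤ b → 0 ≤ c →
      orliczValue φ a (orliczValue φ b c) = orliczValue φ (orliczValue φ a b) c) :
    IsHomMonoid (orliczValue φ) where
  hom hc a b := orliczValue_smul φ hc a b
  mono ha hb := orliczValue_mono hφ ha hb
  one_zero := orliczValue_eq_one hφ zero_le_one le_rfl hφ.map_e1
  zero_one := orliczValue_eq_one hφ le_rfl zero_le_one hφ.map_e2
  assoc ha hb hc := hassoc _ _ _ ha hb hc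

theorem orliczValue_one_one_le {φ : ℝ × ℝ → ℝ} (hφ : IsPhi2 φ) : orliczValue φ 1 1 ≤ 2 := by
  have := orliczValue_add_le hφ (zero_le_one' ℝ) le_rfl le_rfl (zero_le_one' ℝ)
  rw [orliczValue_eq_one hφ zero_le_one le_rfl hφ.map_e1,
    orliczValue_eq_one hφ le_rfl zero_le_one hφ.map_e2] at this
  norm_num at this
  exact this

/-! ### Balls, and the passage from numbers to convex sets -/

/-- The ball of radius `a` about the origin, given by its support function. -/
noncomputable def ball (n : ℕ) (a : ℝ) (ha : 0 ≤ a) : Ko n :=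
  wulff (fun x => a * ‖x‖) (fun _ => mul_nonneg ha (norm_nonneg _))

theorem supp_ball {n : ℕ} {a : ℝ} (ha : 0 ≤ a) (x : E n) : supp (ball n a ha) x = a * ‖x‖ := by
  refine supp_wulff _ _ (fun c hc x => ?_) (fun x y => ?_) x
  · rw [norm_smul, Real.norm_of_nonneg hc.le]
    ring
  · rw [← mul_add]
    exact mul_le_mul_of_nonneg_left (norm_add_le x y) ha

theorem ball_mem_Ks {n : ℕ} {a : ℝ} (ha : 0 ≤ a) : ball n a ha ∈ Ks n :=
  wulff_mem_Ks fun x => by rw [norm_neg]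

theorem supp_orliczAdd_eq_orliczValue {n : ℕ} {φ : ℝ × ℝ → ℝ} (hφ : IsPhi2 φ) (K L : Ko n)
    (x : E n) : supp (orliczAdd φ K L) x = orliczValue φ (supp K x) (supp L x) :=
  supp_orliczAdd hφ K L x

theorem orliczValue_assoc_of_assocOn {n : ℕ} (hn : 0 < n) {φ : ℝ × ℝ → ℝ} (hφ : IsPhi2 φ)
    {C : Set (Ko n)} (hC : Ks n ⊆ C) (h : AssocOn C (orliczAdd φ)) {a b c : ℝ} (ha : 0 ≤ a)
    (hb : 0 ≤ b) (hc : 0 ≤ c) :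
    orliczValue φ a (orliczValue φ b c) = orliczValue φ (orliczValue φ a b) c := by
  have hunit : ‖EuclideanSpace.basisFun (Fin n) ℝ ⟨0, hn⟩‖ = 1 :=
    OrthonormalBasis.norm_eq_one _ _
  have := congrArg (fun K => supp K (EuclideanSpace.basisFun (Fin n) ℝ ⟨0, hn⟩))
    (h _ (hC (ball_mem_Ks ha)) _ (hC (ball_mem_Ks hb)) _ (hC (ball_mem_Ks hc)))
  simpa only [supp_orliczAdd_eq_orliczValue hφ, supp_ball, hunit, mul_one] using this

theorem lpAdd_assoc {n : ℕ} {p : ℝ≥0∞} (hp : 1 ≤ p) (K L N : Ko n) :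
    lpAdd p K (lpAdd p L N) = lpAdd p (lpAdd p K L) N :=
  eq_of_supp_eq fun x => by
    simp only [supp_lpAdd hp]
    exact lpValue_assoc hp (supp_nonneg _ _) (supp_nonneg _ _) (supp_nonneg _ _)

theorem assocOn_iff_exists_agreeOn_lpAdd {n : ℕ} (hn : 0 < n) {φ : ℝ × ℝ → ℝ} (hφ : IsPhi2 φ)
    {C : Set (Ko n)} (hC : Ks n ⊆ C) (hadd : ∀ K ∈ C, ∀ L ∈ C, orliczAdd φ K L ∈ C) :
    AssocOn C (orliczAdd φ) ↔
      ∃ p : ℝ≥0∞, 1 ≤ p ∧ AgreeOn C (orliczAdd φ) (lpAdd p) := by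
  constructor
  · intro h
    obtain ⟨p, hp, hF⟩ := (isHomMonoid_orliczValue hφ fun a b c =>
      orliczValue_assoc_of_assocOn hn hφ hC h).exists_eq_lpValue (orliczValue_one_one_le hφ)
    refine ⟨p, hp, fun K _ L _ => eq_of_supp_eq fun x => ?_⟩
    rw [supp_orliczAdd_eq_orliczValue hφ, supp_lpAdd hp,
      hF _ _ (supp_nonneg _ _) (supp_nonneg _ _)]
  · rintro ⟨p, hp, h⟩ K hK L hL N hN
    rw [h K hK _ (hadd L hL N hN), h L hL N hN, h _ (hadd K hK L hL) N hN, h K hK L hL,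
      lpAdd_assoc hp]

end OrliczAddition

theorem theorem5p9 (n : ℕ) (hn : 2 ≤ n) (φ : ℝ × ℝ → ℝ) (hφ : OrliczAddition.IsPhi2 φ) :
    (OrliczAddition.AssocOn (OrliczAddition.Ks n) (OrliczAddition.orliczAdd φ) ↔
      ∃ p : ENNReal, 1 ≤ p ∧
        OrliczAddition.AgreeOn (OrliczAddition.Ks n)
          (OrliczAddition.orliczAdd φ) (OrliczAddition.lpAdd p)) ∧
    (OrliczAddition.AssocOn (Set.univ : Set (OrliczAddition.Ko n)) (OrliczAddition.orliczAdd φ) ↔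
      ∃ p : ENNReal, 1 ≤ p ∧
        OrliczAddition.AgreeOn (Set.univ : Set (OrliczAddition.Ko n))
          (OrliczAddition.orliczAdd φ) (OrliczAddition.lpAdd p)) :=
  ⟨OrliczAddition.assocOn_iff_exists_agreeOn_lpAdd (by omega) hφ subset_rfl
      fun _ hK _ hL => OrliczAddition.orliczAdd_mem_Ks φ hK hL,
    OrliczAddition.assocOn_iff_exists_agreeOn_lpAdd (by omega) hφ (Set.subset_univ _)
      fun _ _ _ _ => Set.mem_univ _⟩
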